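/- Let $n\ge 1$, let $M_n$ be the algebra of complex $n\times n$ matrices, and let $\mathbb{D}\le \mathrm{SU}(n)$ be the group of diagonal special unitary $n\times n$ matrices. For every $X\in\mathbb{D}$ there are unique real numbers $$x_1\le x_2\le\cdots\le x_n\le x_1+1,\qquad \sum_{j=1}^n x_j=0,$$ such that $\exp(2\pi i x_1),\dots,\exp(2\pi i x_n)$ are the eigenvalues of $X$, counted with multiplicity; put $\lambda_j(X):=\exp(2\pi i x_j)$. Let $\phi:\mathbb{D}\to M_n$ be a continuous map such that, for all $X,Y\in\mathbb{D}$, the matrices $\phi(X)$ and $X$ have the same set of eigenvalues, and $\phi(X)$ and $\phi(Y)$ commute whenever $X$ and $Y$ do. Then there is $T\in\mathrm{GL}(n,\mathbb{C})$ such that at least one of the following holds: (a) $\phi(X)=TXT^{-1}$ for all $X\in\mathbb{D}$; (b) $\phi(X)=T\,\mathrm{diag}(\lambda_1(X),\dots,\lambda_n(X))\,T^{-1}$ for all $X\in\mathbb{D}$. -/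

import Mathlib

/-- The group of diagonal special unitary `n × n` matrices, as a subgroup of `SU(n)`. -/
def diagSU (n : ℕ) : Subgroup (Matrix.specialUnitaryGroup (Fin n) ℂ) where
  carrier := {X | (X : Matrix (Fin n) (Fin n) ℂ).IsDiag}
  one_mem' := Matrix.isDiag_one
  mul_mem' := by
    intro X Y hX hY
    have hX' : (X : Matrix (Fin n) (Fin n) ℂ).IsDiag := hX
    have hY' : (Y : Matrix (Fin n) (Fin n) ℂ).IsDiag := hY
    change ((X : Matrix (Fin n) (Fin n) ℂ) * (Y : Matrix (Fin n) (Fin n) ℂ)).IsDiag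
    rw [← hX'.diagonal_diag, ← hY'.diagonal_diag, Matrix.diagonal_mul_diagonal]
    exact Matrix.isDiag_diagonal _
  inv_mem' := by
    intro X hX
    exact Matrix.IsDiag.conjTranspose hX

/-- The underlying complex matrix of an element of `diagSU n`. -/
def diagSU.toMatrix {n : ℕ} (X : diagSU n) : Matrix (Fin n) (Fin n) ℂ :=
  ((X : Matrix.specialUnitaryGroup (Fin n) ℂ) : Matrix (Fin n) (Fin n) ℂ)

/-- `φ(X)` and `X` have the same spectrum, as sets of complex numbers. -/
def SpectrumPreserving {n : ℕ} (φ : diagSU n → Matrix (Fin n) (Fin n) ℂ) : Prop :=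
  ∀ X : diagSU n, spectrum ℂ (φ X) = spectrum ℂ (diagSU.toMatrix X)

/-- `φ(X)` and `φ(Y)` commute whenever `X` and `Y` do. -/
def CommutativityPreserving {n : ℕ} (φ : diagSU n → Matrix (Fin n) (Fin n) ℂ) : Prop :=
  ∀ X Y : diagSU n, Commute (diagSU.toMatrix X) (diagSU.toMatrix Y) → Commute (φ X) (φ Y)

/-- The conjugation `Ad_T A = T A T⁻¹` by an invertible matrix `T`. -/
def matrixAd {n : ℕ} (T : GL (Fin n) ℂ) (A : Matrix (Fin n) (Fin n) ℂ) :
    Matrix (Fin n) (Fin n) ℂ :=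
  (T : Matrix (Fin n) (Fin n) ℂ) * A * ((T⁻¹ : GL (Fin n) ℂ) : Matrix (Fin n) (Fin n) ℂ)

/-- The number `exp(2πi t)` on the unit circle. -/
noncomputable def circleExp (t : ℝ) : ℂ :=
  Complex.exp (2 * (Real.pi : ℂ) * Complex.I * (t : ℂ))

/-- `x₁ ≤ ⋯ ≤ xₙ ≤ x₁ + 1`, `∑ xⱼ = 0`, and the numbers `exp(2πi xⱼ)` are the eigenvalues of `X`,
listed with algebraic multiplicity. For a monotone `x`, the field `spread` says exactly that
the last entry is at most the first one plus `1`. -/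
structure IsOrderedEigenangles {n : ℕ} (X : Matrix (Fin n) (Fin n) ℂ) (x : Fin n → ℝ) : Prop where
  mono : Monotone x
  spread : ∀ i j, x i ≤ x j + 1
  sum_eq_zero : ∑ j, x j = 0
  roots_eq : X.charpoly.roots = (Finset.univ : Finset (Fin n)).val.map (fun j => circleExp (x j))

/-! The torus is abelian, so all `φ X` commute with `φ Z` for one `Z` with distinct eigenvalues.
Since `φ Z` also has distinct eigenvalues, a single `T` diagonalizes every `φ X`, with entries `f i
X` that are continuous choices of an eigenvalue of `X`.

To classify such choices, cover the torus by the images of the alcove under `x ↦ torusPoint (x ∘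
u)`, one for each permutation `u`. On the connected open alcove the eigenvalues are distinct, so a
choice is the eigenvalue in a fixed position `t u`. Images of the alcove meet where all eigenvalues
but one coincide, and comparing there ties `t u` to `t v`. By `Equiv.Perm.const_or_eval_of_local`,
`t` is then constant (an ordered eigenvalue) or evaluation at an index (a diagonal entry).

The two kinds cannot both occur among the `f i`: at a suitable regular element two of them would
agree, although the `f i` are distinct there. Hence all are of one kind, and a permutation matrix
absorbs the relabelling. -/

/-! ### Angles and the unit circle -/

lemma circleExp_zero : circleExp 0 = 1 := by
  simp [circleExp]

lemma circleExp_sum {ι : Type*} (s : Finset ι) (x : ι → ℝ) :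
    circleExp (∑ i ∈ s, x i) = ∏ i ∈ s, circleExp (x i) := by
  simp only [circleExp, ← Complex.exp_sum, ← Finset.mul_sum]
  push_cast
  rfl

lemma circleExp_eq_iff {a b : ℝ} : circleExp a = circleExp b ↔ ∃ m : ℤ, a = b + m := by
  unfold circleExp
  rw [Complex.exp_eq_exp_iff_exists_int]
  refine exists_congr fun m => ?_
  have h : (2 * (Real.pi : ℂ) * Complex.I) ≠ 0 := Complex.two_pi_I_ne_zero
  rw [show 2 * (Real.pi : ℂ) * Complex.I * b + m * (2 * Real.pi * Complex.I)
    = 2 * (Real.pi : ℂ) * Complex.I * ((b + m : ℝ) : ℂ) by push_cast; ring]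
  rw [mul_right_inj' h, Complex.ofReal_inj]

lemma circleExp_sub_one (a : ℝ) : circleExp (a - 1) = circleExp a :=
  circleExp_eq_iff.2 ⟨-1, by push_cast; ring⟩

lemma norm_circleExp (a : ℝ) : ‖circleExp a‖ = 1 := by
  rw [circleExp, show 2 * (Real.pi : ℂ) * Complex.I * a = ((2 * Real.pi * a : ℝ) : ℂ) * Complex.I by
    push_cast; ring]
  exact Complex.norm_exp_ofReal_mul_I _

lemma continuous_circleExp : Continuous circleExp := by
  unfold circleExp
  fun_prop

lemma exists_circleExp_eq {z : ℂ} (hz : ‖z‖ = 1) : ∃ a : ℝ, 0 ≤ a ∧ a < 1 ∧ circleExp a = z := by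
  refine ⟨Int.fract (z.arg / (2 * Real.pi)), Int.fract_nonneg _, Int.fract_lt_one _, ?_⟩
  have h : circleExp (z.arg / (2 * Real.pi)) = z := by
    rw [circleExp, ← Complex.norm_mul_exp_arg_mul_I z, hz]
    simp only [Complex.ofReal_one, one_mul]
    congr 1
    rw [← one_mul (Complex.exp _), ← Complex.ofReal_one, ← hz, Complex.norm_mul_exp_arg_mul_I]
    have : (Real.pi : ℂ) ≠ 0 := by exact_mod_cast Real.pi_ne_zero
    push_cast
    field_simp
  rw [← h, circleExp_eq_iff]
  refine ⟨-⌊z.arg / (2 * Real.pi)⌋, ?_⟩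
  rw [h, Int.fract]
  push_cast
  ring

lemma exists_perm_of_map_univ_eq {α β : Type*} [Fintype α] {f g : α → β}
    (h : (Finset.univ : Finset α).val.map f = (Finset.univ : Finset α).val.map g) :
    ∃ u : Equiv.Perm α, ∀ a, g (u a) = f a := by
  classical
  have hc : ∀ c, Fintype.card {a // f a = c} = Fintype.card {a // g a = c} := by
    intro c
    have := congrArg (Multiset.count c) h
    rw [Multiset.count_map, Multiset.count_map] at this
    rw [Fintype.card_subtype, Fintype.card_subtype]
    simpa [Finset.card, Finset.filter_val, eq_comm] using this
  exact ⟨Equiv.ofFiberEquiv fun c => Fintype.equivOfCardEq (hc c), fun a =>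
    Equiv.ofFiberEquiv_map _ a⟩

lemma map_univ_comp_perm {α β : Type*} [Fintype α] (f : α → β) (u : Equiv.Perm α) :
    (Finset.univ : Finset α).val.map (fun a => f (u a)) = (Finset.univ : Finset α).val.map f := by
  conv_rhs => rw [← Multiset.map_univ_val_equiv u, Multiset.map_map]
  rfl

/-! ### Existence and uniqueness of ordered angles -/

/-- The closed fundamental alcove: ordered angles of spread at most one and total zero. -/
def alcove (n : ℕ) : Set (Fin n → ℝ) :=
  {x | Monotone x ∧ (∀ i j, x i ≤ x j + 1) ∧ ∑ j, x j = 0}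

/-- The right-hand side depends only on the angles modulo integer shifts of total zero and up to
order, which gives uniqueness. If `x j ≤ c`, only indices above `j` can contribute a negative floor,
and by the spread bound it is at least `-1`. If `c < x j`, all indices from `j` on contribute at
most `-1` and the others at most `0`. -/
lemma le_iff_sum_floor {n : ℕ} {x : Fin n → ℝ} (hm : Monotone x) (hs : ∀ i j, x i ≤ x j + 1)
    (j : Fin n) (c : ℝ) : x j ≤ c ↔ -((Finset.Ioi j).card : ℤ) ≤ ∑ i, ⌊c - x i⌋ := by
  constructor
  · intro h
    calc -((Finset.Ioi j).card : ℤ) = ∑ i, if i ∈ Finset.Ioi j then (-1 : ℤ) else 0 := by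
          rw [Finset.sum_ite_mem]; simp
      _ ≤ _ := by
        refine Finset.sum_le_sum fun i _ => ?_
        split_ifs with hi
        · rw [Int.le_floor]; push_cast; linarith [hs i j]
        · rw [Int.le_floor]
          have := hm (not_lt.1 (by simpa using hi) : i ≤ j)
          push_cast; linarith
  · contrapose!
    intro h
    calc ∑ i, ⌊c - x i⌋ ≤ ∑ i, if i ∈ Finset.Ici j then (-1 : ℤ) else 0 := by
          refine Finset.sum_le_sum fun i _ => ?_
          split_ifs with hi
          · have := hm (by simpa using hi : j ≤ i)
            have : ⌊c - x i⌋ < 0 := Int.floor_lt.2 (by push_cast; linarith)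
            lia
          · have : ⌊c - x i⌋ < 1 := Int.floor_lt.2 (by push_cast; linarith [hs j i])
            lia
      _ < _ := by
        rw [Finset.sum_ite_mem]
        have : (Finset.Ioi j).card < (Finset.Ici j).card :=
          Finset.card_lt_card (by
            rw [← Finset.Ioi_insert]; exact Finset.ssubset_insert (by simp))
        simp only [Finset.univ_inter, Finset.sum_const, nsmul_eq_mul]
        lia

lemma alcove_eq_of_circleExp_eq {n : ℕ} {x y : Fin n → ℝ} (hx : x ∈ alcove n) (hy : y ∈ alcove n)
    (u : Equiv.Perm (Fin n)) (h : ∀ j, circleExp (y (u j)) = circleExp (x j)) : x = y := by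
  choose m hm using fun j => circleExp_eq_iff.1 (h j)
  have hsum : ∑ j, m j = 0 := by
    have h1 : ∑ j, y (u j) = ∑ j, x j + ∑ j, (m j : ℝ) := by
      rw [← Finset.sum_add_distrib]; exact Finset.sum_congr rfl fun j _ => hm j
    rw [Equiv.sum_comp u y, hx.2.2, hy.2.2] at h1
    have : ∑ j, (m j : ℝ) = 0 := by linarith
    exact_mod_cast this
  have key : ∀ c : ℝ, ∑ i, ⌊c - x i⌋ = ∑ i, ⌊c - y i⌋ := by
    intro c
    rw [← Equiv.sum_comp u (fun i => ⌊c - y i⌋)]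
    have : ∀ i, ⌊c - y (u i)⌋ = ⌊c - x i⌋ - m i := by
      intro i
      rw [hm i, ← sub_sub, Int.floor_sub_intCast]
    simp only [this, Finset.sum_sub_distrib, hsum, sub_zero]
  funext j
  refine eq_of_forall_ge_iff fun c => ?_
  rw [le_iff_sum_floor hx.1 hx.2.1, le_iff_sum_floor hy.1 hy.2.1, key]

lemma exists_spread_sum_zero {n : ℕ} (m : ℕ) : ∀ x : Fin n → ℝ, (∀ i j, x i ≤ x j + 1) →
    ∑ j, x j = m → ∃ y : Fin n → ℝ, (∀ i j, y i ≤ y j + 1) ∧ ∑ j, y j = 0 ∧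
      ∀ j, circleExp (y j) = circleExp (x j) := by
  induction m with
  | zero => exact fun x hx hs => ⟨x, hx, by simpa using hs, fun _ => rfl⟩
  | succ m ih =>
    intro x hx hs
    have hn : Nonempty (Fin n) := by
      by_contra h
      rw [not_nonempty_iff] at h
      simp at hs
      linarith
    obtain ⟨k, hk⟩ := Finite.exists_max x
    -- Lowering a largest angle by `1` keeps the spread at most `1` and reduces the sum by `1`.
    obtain ⟨y, h1, h2, h3⟩ := ih (Function.update x k (x k - 1)) (by
      intro i j
      by_cases hi : i = k <;> by_cases hj : j = k <;>
        simp only [Function.update_apply, hi, hj, if_true, if_false] <;>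
        linarith [hx k j, hx i j, hk i]) (by
      rw [Finset.sum_update_of_mem (Finset.mem_univ k)]
      rw [← Finset.add_sum_erase _ _ (Finset.mem_univ k)] at hs
      rw [Finset.sdiff_singleton_eq_erase]
      push_cast at hs
      linarith)
    refine ⟨y, h1, h2, fun j => (h3 j).trans ?_⟩
    by_cases hj : j = k
    · subst hj; simp [circleExp_sub_one]
    · simp [hj]

lemma exists_alcove_circleExp_eq {n : ℕ} {z : Fin n → ℂ} (hz : ∀ j, ‖z j‖ = 1)
    (hp : ∏ j, z j = 1) :
    ∃ x ∈ alcove n, ∃ u : Equiv.Perm (Fin n), ∀ j, circleExp (x (u j)) = z j := by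
  choose a ha0 ha1 ha using fun j => exists_circleExp_eq (hz j)
  obtain ⟨m, hm⟩ : ∃ m : ℕ, ∑ j, a j = m := by
    have h : circleExp (∑ j, a j) = circleExp 0 := by
      rw [circleExp_sum, circleExp_zero, ← hp]; exact Finset.prod_congr rfl fun j _ => ha j
    obtain ⟨m, hm⟩ := circleExp_eq_iff.1 h
    have h0 : (0 : ℝ) ≤ m := by
      rw [← zero_add (m : ℝ), ← hm]; exact Finset.sum_nonneg fun j _ => ha0 j
    lift m to ℕ using by exact_mod_cast h0
    exact ⟨m, by simpa using hm⟩
  obtain ⟨y, h1, h2, h3⟩ := exists_spread_sum_zero m a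
    (fun i j => by linarith [ha0 j, ha1 i]) hm
  refine ⟨y ∘ Tuple.sort y, ⟨Tuple.monotone_sort y, fun i j => h1 _ _, ?_⟩,
    (Tuple.sort y).symm, fun j => ?_⟩
  · exact (Equiv.sum_comp (Tuple.sort y) y).trans h2
  · simp [h3, ha]

/-! ### A dichotomy for functions on permutations -/

/-- With `p = t 1`, either every position `k` has a `u` with `u k = p = t u`, and `H` forces `t = p`
everywhere; or some `k` has none, and then every value `q` is attained as `v p = q = t v`, so `H`
makes `t` evaluation at `p`. -/
lemma Equiv.Perm.const_or_eval_of_local {α : Type*} [DecidableEq α] [Nonempty α]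
    (t : Equiv.Perm α → α)
    (H : ∀ u v : Equiv.Perm α, ∀ i, t u = u i → v i = u i → t v = t u) :
    (∃ p, ∀ u, t u = p) ∨ ∃ i, ∀ u, t u = u i := by
  obtain ⟨p, hp⟩ : ∃ p, t 1 = p := ⟨_, rfl⟩
  by_cases hall : ∀ k, ∃ u : Equiv.Perm α, u k = p ∧ t u = p
  · refine Or.inl ⟨p, fun v => ?_⟩
    obtain ⟨u, hu, ht⟩ := hall (v.symm p)
    rw [← ht]
    exact H u v _ (by rw [ht, hu]) (by rw [hu]; simp)
  · push Not at hall
    obtain ⟨k, hk⟩ := hall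
    have hkp : k ≠ p := fun h => hk 1 (by simp [h]) hp
    have hN : ∀ q, ∃ v : Equiv.Perm α, v p = q ∧ t v = q := by
      intro q
      by_cases hq : q = p
      · exact ⟨1, by simp [hq], hp.trans hq.symm⟩
      -- `u` fixes `p` and sends `k` to `q`.
      set u : Equiv.Perm α := Equiv.swap k q with hu
      have hup : u p = p := Equiv.swap_apply_of_ne_of_ne hkp.symm (Ne.symm hq)
      have huk : u k = q := Equiv.swap_apply_left _ _
      have htu : t u = p := by
        rw [← hp]; exact H 1 u p (by simp [hp]) (by simp [hup])
      set v : Equiv.Perm α := Equiv.swap p q * u with hv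
      have hvp : v p = q := by simp [hv, hup]
      have hvk : v k = p := by simp [hv, huk]
      refine ⟨v, hvp, ?_⟩
      by_contra hne
      have hnp : t v ≠ p := hk v hvk
      -- If `t v` is neither `p` nor `q`, the swap does not affect it, so `u` and `v` take this
      -- value at the same position.
      have : t u = t v := by
        refine H v u (v.symm (t v)) (by simp) ?_
        rw [Equiv.apply_symm_apply]
        have h2 : Equiv.swap p q (u (v.symm (t v))) = t v := by
          rw [← Equiv.Perm.mul_apply, ← hv, Equiv.apply_symm_apply]
        rw [Equiv.swap_apply_eq_iff, Equiv.swap_apply_of_ne_of_ne hnp hne] at h2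
        exact h2
      exact hnp (this ▸ htu)
    refine Or.inr ⟨p, fun v => ?_⟩
    obtain ⟨u, hu, ht⟩ := hN (v p)
    rw [← ht]
    exact H u v p (ht.trans hu.symm) hu.symm

/-! ### The diagonal torus, covered by permuted alcoves -/

lemma diagSU.toMatrix_eq_diagonal {n : ℕ} (X : diagSU n) :
    diagSU.toMatrix X = Matrix.diagonal (Matrix.diag (diagSU.toMatrix X)) :=
  (Matrix.IsDiag.diagonal_diag X.2).symm

lemma diagSU.ext_diag {n : ℕ} {X Y : diagSU n}
    (h : ∀ i, diagSU.toMatrix X i i = diagSU.toMatrix Y i i) : X = Y := by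
  apply Subtype.ext
  apply Subtype.ext
  change diagSU.toMatrix X = diagSU.toMatrix Y
  rw [diagSU.toMatrix_eq_diagonal X, diagSU.toMatrix_eq_diagonal Y]
  congr 1
  exact funext h

lemma diagSU.norm_apply_eq_one {n : ℕ} (X : diagSU n) (i : Fin n) :
    ‖diagSU.toMatrix X i i‖ = 1 := by
  have h : diagSU.toMatrix X * star (diagSU.toMatrix X) = 1 :=
    Matrix.mem_unitaryGroup_iff.1 (Matrix.mem_specialUnitaryGroup_iff.1 X.1.2).1
  rw [diagSU.toMatrix_eq_diagonal X, Matrix.star_eq_conjTranspose, Matrix.diagonal_conjTranspose,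
    Matrix.diagonal_mul_diagonal] at h
  have h1 := congrFun (congrFun h i) i
  simp only [Matrix.diagonal_apply_eq, Matrix.one_apply_eq, Matrix.diag_apply, Pi.star_apply,
    RCLike.star_def, Complex.mul_conj'] at h1
  have h2 : ‖diagSU.toMatrix X i i‖ ^ 2 = 1 := by exact_mod_cast h1
  exact (pow_eq_one_iff_of_nonneg (norm_nonneg _) two_ne_zero).1 h2

lemma diagSU.prod_diag_eq_one {n : ℕ} (X : diagSU n) : ∏ i, diagSU.toMatrix X i i = 1 := by
  have h : (diagSU.toMatrix X).det = 1 := (Matrix.mem_specialUnitaryGroup_iff.1 X.1.2).2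
  rw [diagSU.toMatrix_eq_diagonal X, Matrix.det_diagonal] at h
  exact h

/-- The element of the diagonal torus with the given angles, normalised to have mean zero. -/
noncomputable def torusPoint {n : ℕ} (x : Fin n → ℝ) : diagSU n :=
  ⟨⟨Matrix.diagonal fun i => circleExp (x i - (∑ k, x k) / n), by
    rw [Matrix.mem_specialUnitaryGroup_iff]
    constructor
    · rw [Matrix.mem_unitaryGroup_iff, Matrix.star_eq_conjTranspose,
        Matrix.diagonal_conjTranspose, Matrix.diagonal_mul_diagonal, ← Matrix.diagonal_one]
      congr 1
      funext i
      simp [Complex.mul_conj', norm_circleExp]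
    · rw [Matrix.det_diagonal, ← circleExp_sum, ← circleExp_zero, Finset.sum_sub_distrib]
      congr 1
      rcases Nat.eq_zero_or_pos n with rfl | hn
      · simp
      · have : (n : ℝ) ≠ 0 := by positivity
        simp
        field_simp
        simp⟩, Matrix.isDiag_diagonal _⟩

lemma toMatrix_torusPoint {n : ℕ} {x : Fin n → ℝ} (hx : ∑ k, x k = 0) :
    diagSU.toMatrix (torusPoint x) = Matrix.diagonal fun i => circleExp (x i) := by
  simp [diagSU.toMatrix, torusPoint, hx]

lemma continuous_torusPoint {n : ℕ} : Continuous (torusPoint (n := n)) := by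
  refine Continuous.subtype_mk (Continuous.subtype_mk ?_ _) _
  refine Continuous.matrix_diagonal (continuous_pi fun i => ?_)
  exact continuous_circleExp.comp (by fun_prop)

lemma sum_comp_perm_eq_zero {n : ℕ} {x : Fin n → ℝ} (hx : x ∈ alcove n) (u : Equiv.Perm (Fin n)) :
    ∑ k, (x ∘ u) k = 0 :=
  (Equiv.sum_comp u x).trans hx.2.2

lemma torusPoint_comp_apply {n : ℕ} {x : Fin n → ℝ} (hx : x ∈ alcove n)
    (u : Equiv.Perm (Fin n)) (i : Fin n) :
    diagSU.toMatrix (torusPoint (x ∘ u)) i i = circleExp (x (u i)) := by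
  rw [toMatrix_torusPoint (sum_comp_perm_eq_zero hx u)]
  simp

lemma exists_eq_torusPoint_comp {n : ℕ} (X : diagSU n) :
    ∃ x ∈ alcove n, ∃ u : Equiv.Perm (Fin n), X = torusPoint (x ∘ u) := by
  obtain ⟨x, hx, u, h⟩ := exists_alcove_circleExp_eq (z := fun j => diagSU.toMatrix X j j)
    (diagSU.norm_apply_eq_one X) (diagSU.prod_diag_eq_one X)
  exact ⟨x, hx, u, diagSU.ext_diag fun i => by rw [torusPoint_comp_apply hx, h]⟩

lemma diagSU.charpoly_roots {n : ℕ} (X : diagSU n) :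
    (diagSU.toMatrix X).charpoly.roots =
      (Finset.univ : Finset (Fin n)).val.map (fun j => diagSU.toMatrix X j j) := by
  conv_lhs => rw [diagSU.toMatrix_eq_diagonal X]
  rw [Matrix.charpoly_diagonal]
  exact Polynomial.roots_multiset_prod_X_sub_C
    ((Finset.univ : Finset (Fin n)).val.map fun j => diagSU.toMatrix X j j) ▸ by
      rw [Multiset.map_map]; rfl

lemma isOrderedEigenangles_iff {n : ℕ} (X : diagSU n) (x : Fin n → ℝ) :
    IsOrderedEigenangles (diagSU.toMatrix X) x ↔
      x ∈ alcove n ∧ ∃ u : Equiv.Perm (Fin n), X = torusPoint (x ∘ u) := by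
  constructor
  · intro h
    have hx : x ∈ alcove n := ⟨h.mono, h.spread, h.sum_eq_zero⟩
    obtain ⟨u, hu⟩ := exists_perm_of_map_univ_eq ((diagSU.charpoly_roots X).symm.trans h.roots_eq)
    exact ⟨hx, u, diagSU.ext_diag fun i => by rw [torusPoint_comp_apply hx, hu]⟩
  · rintro ⟨hx, u, rfl⟩
    refine ⟨hx.1, hx.2.1, hx.2.2, ?_⟩
    rw [diagSU.charpoly_roots]
    simp only [torusPoint_comp_apply hx]
    exact map_univ_comp_perm (fun i => circleExp (x i)) u

lemma existsUnique_isOrderedEigenangles {n : ℕ} (X : diagSU n) :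
    ∃! x : Fin n → ℝ, IsOrderedEigenangles (diagSU.toMatrix X) x := by
  obtain ⟨x, hx, u, h⟩ := exists_eq_torusPoint_comp X
  refine ⟨x, (isOrderedEigenangles_iff X x).2 ⟨hx, u, h⟩, fun y hy => ?_⟩
  obtain ⟨hy, v, h'⟩ := (isOrderedEigenangles_iff X y).1 hy
  refine alcove_eq_of_circleExp_eq hy hx (v.symm.trans u) fun j => ?_
  have := congrArg (fun Y => diagSU.toMatrix Y (v.symm j) (v.symm j)) (h.symm.trans h')
  simpa only [torusPoint_comp_apply hx, torusPoint_comp_apply hy, Equiv.apply_symm_apply, Equiv.trans_apply] using this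

/-! ### Open alcove and edge points -/

/-- The open fundamental alcove. -/
def openAlcove (n : ℕ) : Set (Fin n → ℝ) :=
  {x | StrictMono x ∧ (∀ i j, x i < x j + 1) ∧ ∑ j, x j = 0}

lemma openAlcove_subset {n : ℕ} : openAlcove n ⊆ alcove n :=
  fun _ h => ⟨h.1.monotone, fun i j => (h.2.1 i j).le, h.2.2⟩

/-- Strict inequalities survive any positive weight on `y`. This gives both convexity of the open
alcove and its density in the closed one. -/
lemma convexCombo_mem_openAlcove {n : ℕ} {x y : Fin n → ℝ} (hx : x ∈ alcove n)
    (hy : y ∈ openAlcove n) {a b : ℝ} (ha : 0 ≤ a) (hb : 0 < b) (hab : a + b = 1) :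
    a • x + b • y ∈ openAlcove n := by
  refine ⟨fun i j hij => ?_, fun i j => ?_, ?_⟩
  · have h1 := mul_le_mul_of_nonneg_left (hx.1 hij.le) ha
    have h2 := mul_lt_mul_of_pos_left (hy.1 hij) hb
    simp only [Pi.add_apply, Pi.smul_apply, smul_eq_mul]
    linarith
  · have h1 := mul_le_mul_of_nonneg_left (hx.2.1 i j) ha
    have h2 := mul_lt_mul_of_pos_left (hy.2.1 i j) hb
    simp only [Pi.add_apply, Pi.smul_apply, smul_eq_mul]
    linarith
  · simp [Finset.sum_add_distrib, ← Finset.mul_sum, hx.2.2, hy.2.2]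

lemma isPreconnected_openAlcove {n : ℕ} : IsPreconnected (openAlcove n) := by
  refine Convex.isPreconnected (convex_iff_forall_pos.2 fun x hx y hy a b ha hb hab => ?_)
  exact convexCombo_mem_openAlcove (openAlcove_subset hx) hy ha.le hb hab

lemma circleExp_injective_of_mem_openAlcove {n : ℕ} {x : Fin n → ℝ} (hx : x ∈ openAlcove n) :
    Function.Injective fun i => circleExp (x i) := by
  intro i j h
  obtain ⟨m, hm⟩ := circleExp_eq_iff.1 h
  have h1 := hx.2.1 i j
  have h2 := hx.2.1 j i
  have h3 : (m : ℝ) < 1 := by linarith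
  have h4 : (-1 : ℝ) < m := by linarith
  have h5 : m < 1 := by exact_mod_cast h3
  have h6 : -1 < m := by exact_mod_cast h4
  obtain rfl : m = 0 := by lia
  exact hx.1.injective (by simpa using hm)

/-- The barycentre of the alcove. -/
noncomputable def barycentre (n : ℕ) (i : Fin n) : ℝ := i / n - (n - 1) / (2 * n)

lemma sum_fin_cast (n : ℕ) : ∑ i : Fin n, (i : ℝ) = n * (n - 1) / 2 := by
  induction n with
  | zero => simp
  | succ n ih =>
    rw [Fin.sum_univ_castSucc]
    simp only [Fin.val_castSucc, Fin.val_last, ih]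
    push_cast
    ring

lemma barycentre_mem {n : ℕ} : barycentre n ∈ openAlcove n := by
  rcases Nat.eq_zero_or_pos n with rfl | hn
  · exact ⟨fun i => i.elim0, fun i => i.elim0, by simp⟩
  have hn' : (0 : ℝ) < n := by exact_mod_cast hn
  refine ⟨fun i j hij => ?_, fun i j => ?_, ?_⟩
  · have : (i : ℝ) < j := by exact_mod_cast hij
    simp only [barycentre]
    gcongr
  · have hi : (i : ℝ) / n < 1 := (div_lt_one hn').2 (by exact_mod_cast i.2)
    have hj : (0 : ℝ) ≤ (j : ℝ) / n := by positivity
    simp only [barycentre]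
    linarith
  · simp only [barycentre, Finset.sum_sub_distrib, ← Finset.sum_div, sum_fin_cast]
    simp
    field_simp
    ring

lemma alcove_subset_closure {n : ℕ} : alcove n ⊆ closure (openAlcove n) := by
  intro x hx
  have ht : Filter.Tendsto (fun k : ℕ => (1 - 1 / ((k : ℝ) + 1)) • x +
      (1 / ((k : ℝ) + 1)) • barycentre n) Filter.atTop (nhds x) := by
    have h0 := tendsto_one_div_add_atTop_nhds_zero_nat (𝕜 := ℝ)
    have := ((tendsto_const_nhds (x := (1 : ℝ))).sub h0).smul_const x |>.add
      (h0.smul_const (barycentre n))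
    simpa using this
  refine mem_closure_of_tendsto ht (Filter.Eventually.of_forall fun k => ?_)
  have h1 : 1 / ((k : ℝ) + 1) ≤ 1 := (div_le_one (by positivity)).2 (by simp)
  exact convexCombo_mem_openAlcove hx barycentre_mem (by linarith) (by positivity) (by ring)

/-- A point of the alcove all of whose angles, except the one in position `p`, agree modulo `1`. -/
noncomputable def edgePoint {n : ℕ} (p i : Fin n) : ℝ :=
  (if i < p then 0 else if i = p then 1 / 2 else 1) - ((n - 1 - p) + 1 / 2) / n

lemma edgePoint_mem {n : ℕ} (p : Fin n) : edgePoint p ∈ alcove n := by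
  have hn : (n : ℝ) ≠ 0 := by exact_mod_cast p.pos.ne'
  refine ⟨fun i j hij => ?_, fun i j => ?_, ?_⟩
  · simp only [edgePoint]
    gcongr
    split_ifs <;> first | (exfalso; lia) | norm_num
  · simp only [edgePoint]
    split_ifs <;> linarith
  · have h : ∀ i : Fin n, (if i < p then (0 : ℝ) else if i = p then 1 / 2 else 1) =
        (if i = p then 1 / 2 else 0) + if i ∈ Finset.Ioi p then 1 else 0 := by
      intro i
      simp only [Finset.mem_Ioi]
      rcases lt_trichotomy i p with h | h | h
      · simp [h, h.ne, h.not_gt]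
      · simp [h]
      · simp [h, h.ne', h.not_gt]
    -- There are `n - 1 - p` indices above `p`, so the term subtracted in `edgePoint` is the mean.
    have hp : ((n - 1 - p : ℕ) : ℝ) = n - 1 - p := by
      rw [Nat.cast_sub (by have := p.2; lia), Nat.cast_sub (by have := p.2; lia)]; simp
    simp only [edgePoint, Finset.sum_sub_distrib, h, Finset.sum_add_distrib, Finset.sum_ite_mem]
    simp [hp]
    field_simp
    ring

lemma circleExp_edgePoint_eq {n : ℕ} {p i j : Fin n} (hi : i ≠ p) (hj : j ≠ p) :
    circleExp (edgePoint p i) = circleExp (edgePoint p j) := by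
  have h : ∀ i, i ≠ p → circleExp (edgePoint p i) =
      circleExp (-(((n : ℝ) - 1 - p) + 1 / 2) / n) := by
    intro i hi
    rw [circleExp_eq_iff]
    rcases lt_or_gt_of_ne hi with h | h
    · exact ⟨0, by simp only [edgePoint, h, if_true]; push_cast; ring⟩
    · exact ⟨1, by simp only [edgePoint, hi, h.not_gt, if_false]; push_cast; ring⟩
  rw [h i hi, h j hj]

lemma circleExp_edgePoint_ne {n : ℕ} {p i : Fin n} (hi : i ≠ p) :
    circleExp (edgePoint p i) ≠ circleExp (edgePoint p p) := by
  intro h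
  obtain ⟨m, hm⟩ := circleExp_eq_iff.1 h
  have h2 : (2 * m : ℝ) = 1 ∨ (2 * m : ℝ) = -1 := by
    rcases lt_or_gt_of_ne hi with h | h
    · right; simp [edgePoint, h] at hm; linarith
    · left; simp [edgePoint, hi, h.not_gt] at hm; linarith
  have h3 : 2 * m = 1 ∨ 2 * m = -1 := by exact_mod_cast h2
  lia

/-! ### Continuous selections of an eigenvalue -/

/-- The closed conditions `g x = circleExp (x t)` are mutually exclusive on the open alcove, so
connectedness singles out one `t`; density extends it to the closed alcove. -/
lemma exists_selection_on_alcove {n : ℕ} (g : (Fin n → ℝ) → ℂ) (hg : Continuous g)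
    (hsel : ∀ x ∈ alcove n, ∃ j, g x = circleExp (x j)) :
    ∃ t, ∀ x ∈ alcove n, g x = circleExp (x t) := by
  have hc : ∀ t, IsClosed {x : Fin n → ℝ | g x = circleExp (x t)} := fun t =>
    isClosed_eq hg (continuous_circleExp.comp (continuous_apply t))
  obtain ⟨t, ht⟩ := hsel _ (openAlcove_subset barycentre_mem)
  refine ⟨t, fun x hx => ?_⟩
  refine closure_minimal ?_ (hc t) (alcove_subset_closure hx)
  have hU : IsClosed (⋃ s ∈ {s : Fin n | s ≠ t}, {x : Fin n → ℝ | g x = circleExp (x s)}) :=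
    (Set.toFinite _).isClosed_biUnion fun s _ => hc s
  rcases isPreconnected_iff_subset_of_disjoint_closed.1 isPreconnected_openAlcove _ _ (hc t) hU
    (by
      intro y hy
      obtain ⟨s, hs⟩ := hsel y (openAlcove_subset hy)
      by_cases hst : s = t
      · left; subst hst; exact hs
      · right; simp only [Set.mem_iUnion]; exact ⟨s, hst, hs⟩)
    (by
      rw [Set.eq_empty_iff_forall_notMem]
      rintro y ⟨hy, hyt, hyU⟩
      simp only [Set.mem_iUnion] at hyU
      obtain ⟨s, hst, hs⟩ := hyU
      exact hst (circleExp_injective_of_mem_openAlcove hy (hs.symm.trans hyt))) with h | h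
  · exact h
  · exfalso
    have := h barycentre_mem
    simp only [Set.mem_iUnion] at this
    obtain ⟨s, hst, hs⟩ := this
    exact hst (circleExp_injective_of_mem_openAlcove barycentre_mem (hs.symm.trans ht))

/-- A continuous selection of an eigenvalue on the diagonal torus is either an ordered eigenvalue
or a diagonal entry. -/
lemma ordered_or_diag_of_continuous_selection {n : ℕ} (hn : 1 ≤ n) (f : diagSU n → ℂ)
    (hf : Continuous f) (hsel : ∀ X, ∃ j, f X = diagSU.toMatrix X j j) :
    (∃ p, ∀ x ∈ alcove n, ∀ u : Equiv.Perm (Fin n), f (torusPoint (x ∘ u)) = circleExp (x p)) ∨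
      ∃ j, ∀ X, f X = diagSU.toMatrix X j j := by
  have : Nonempty (Fin n) := ⟨⟨0, hn⟩⟩
  have hex : ∀ u : Equiv.Perm (Fin n), ∃ t, ∀ x ∈ alcove n,
      f (torusPoint (x ∘ u)) = circleExp (x t) := by
    intro u
    refine exists_selection_on_alcove (fun x => f (torusPoint (x ∘ u)))
      (hf.comp (continuous_torusPoint.comp (by fun_prop))) fun x hx => ?_
    obtain ⟨j, hj⟩ := hsel (torusPoint (x ∘ u))
    exact ⟨u j, hj.trans (torusPoint_comp_apply hx u j)⟩
  choose t ht using hex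
  have H : ∀ u v : Equiv.Perm (Fin n), ∀ i, t u = u i → v i = u i → t v = t u := by
    intro u v i hu hv
    -- Only the position of the exceptional eigenvalue matters, and `u` and `v` both put it at `i`.
    have hX : torusPoint (edgePoint (u i) ∘ u) = torusPoint (edgePoint (u i) ∘ v) := by
      refine diagSU.ext_diag fun k => ?_
      rw [torusPoint_comp_apply (edgePoint_mem _), torusPoint_comp_apply (edgePoint_mem _)]
      by_cases hk : k = i
      · rw [hk, hv]
      · exact circleExp_edgePoint_eq (fun h => hk (u.injective h))
          (fun h => hk (v.injective (h.trans hv.symm)))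
    have h := ht u _ (edgePoint_mem (u i))
    rw [hX, ht v _ (edgePoint_mem (u i)), hu] at h
    rw [hu]
    by_contra hne
    exact circleExp_edgePoint_ne hne h
  rcases Equiv.Perm.const_or_eval_of_local t H with ⟨p, hp⟩ | ⟨j, hj⟩
  · exact Or.inl ⟨p, fun x hx u => by rw [ht u x hx, hp]⟩
  · refine Or.inr ⟨j, fun X => ?_⟩
    obtain ⟨x, hx, u, rfl⟩ := exists_eq_torusPoint_comp X
    rw [ht u x hx, hj, torusPoint_comp_apply hx]

/-! ### Simultaneous diagonalization -/

lemma Matrix.exists_conj_diagonal_of_spectrum {n : ℕ} {A : Matrix (Fin n) (Fin n) ℂ}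
    {d : Fin n → ℂ} (hd : Function.Injective d) (hA : ∀ i, d i ∈ spectrum ℂ A) :
    ∃ T : GL (Fin n) ℂ, A * (T : Matrix (Fin n) (Fin n) ℂ) =
      (T : Matrix (Fin n) (Fin n) ℂ) * Matrix.diagonal d := by
  have hev : ∀ i, ∃ v, Module.End.HasEigenvector (Matrix.toLin' A) (d i) v := by
    intro i
    have : d i ∈ spectrum ℂ (Matrix.toLin' A) := by rw [Matrix.spectrum_toLin']; exact hA i
    exact (Module.End.hasEigenvalue_iff_mem_spectrum.2 this).exists_hasEigenvector
  choose v hv using hev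
  have hli := Module.End.eigenvectors_linearIndependent' _ d hd v hv
  have hu : IsUnit (Matrix.of v).transpose := Matrix.linearIndependent_cols_iff_isUnit.1 hli
  obtain ⟨T, hT⟩ := hu
  refine ⟨T, ?_⟩
  rw [hT]
  ext i j
  rw [Matrix.mul_diagonal]
  have := congrFun (hv j).apply_eq_smul i
  rw [Matrix.toLin'_apply] at this
  simpa [Matrix.mul_apply, Matrix.mulVec, dotProduct, mul_comm] using this

lemma Matrix.isDiag_of_commute_diagonal {n : ℕ} {S : Matrix (Fin n) (Fin n) ℂ} {d : Fin n → ℂ}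
    (hd : Function.Injective d) (h : Commute S (Matrix.diagonal d)) : S.IsDiag := by
  intro i j hij
  have := congrFun (congrFun h.eq i) j
  rw [Matrix.mul_diagonal, Matrix.diagonal_mul] at this
  have h2 : S i j * (d j - d i) = 0 := by linear_combination this
  exact (mul_eq_zero.1 h2).resolve_right (sub_ne_zero.2 fun h => hij (hd h).symm)

/-- Pairwise commuting matrices `φ X` with the spectra of `X` are simultaneously diagonal. -/
lemma exists_simultaneous_diagonalization {n : ℕ} (φ : diagSU n → Matrix (Fin n) (Fin n) ℂ)
    (hcont : Continuous φ) (hspec : SpectrumPreserving φ) (hcomm : CommutativityPreserving φ) :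
    ∃ (T : GL (Fin n) ℂ) (f : Fin n → diagSU n → ℂ), (∀ i, Continuous (f i)) ∧
      (∀ X, φ X = matrixAd T (Matrix.diagonal fun i => f i X)) ∧
      ∀ X, Set.range (fun i => f i X) = Set.range fun i => diagSU.toMatrix X i i := by
  have hspecX : ∀ X : diagSU n, spectrum ℂ (φ X) = Set.range fun i => diagSU.toMatrix X i i := by
    intro X
    rw [hspec X, diagSU.toMatrix_eq_diagonal X, spectrum_diagonal]
    congr 1
    funext i
    simp
  -- The barycentre supplies a regular element, with `n` distinct eigenvalues.
  set Z : diagSU n := torusPoint (barycentre n ∘ (1 : Equiv.Perm (Fin n))) with hZ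
  have hd := circleExp_injective_of_mem_openAlcove (barycentre_mem (n := n))
  obtain ⟨T, hT⟩ := Matrix.exists_conj_diagonal_of_spectrum (A := φ Z) hd (fun i => by
    rw [hspecX]
    exact ⟨i, (torusPoint_comp_apply (openAlcove_subset barycentre_mem) 1 i)⟩)
  have hTT : (T : Matrix (Fin n) (Fin n) ℂ) * ((T⁻¹ : GL (Fin n) ℂ) : Matrix (Fin n) (Fin n) ℂ) = 1 :=
    Units.mul_inv T
  have hTT' : ((T⁻¹ : GL (Fin n) ℂ) : Matrix (Fin n) (Fin n) ℂ) * (T : Matrix (Fin n) (Fin n) ℂ) = 1 :=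
    Units.inv_mul T
  set S : diagSU n → Matrix (Fin n) (Fin n) ℂ := fun X =>
    ((T⁻¹ : GL (Fin n) ℂ) : Matrix (Fin n) (Fin n) ℂ) * φ X * (T : Matrix (Fin n) (Fin n) ℂ) with hS
  have hSφ : ∀ X, φ X = matrixAd T (S X) := by
    intro X
    simp only [matrixAd, hS]
    calc φ X = 1 * φ X * 1 := by simp
      _ = _ := by rw [← hTT]; simp only [mul_assoc]
  have hSZ : S Z = Matrix.diagonal fun i => circleExp (barycentre n i) := by
    simp only [hS]
    rw [mul_assoc, hT, ← mul_assoc, hTT', one_mul]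
  have hSdiag : ∀ X, (S X).IsDiag := by
    intro X
    refine Matrix.isDiag_of_commute_diagonal hd ?_
    rw [← hSZ]
    have hc : Commute (φ X) (φ Z) := by
      apply hcomm
      rw [diagSU.toMatrix_eq_diagonal X, diagSU.toMatrix_eq_diagonal Z]
      exact Matrix.commute_diagonal _ _
    have hmul : ∀ A B, (S A) * (S B) = ((T⁻¹ : GL (Fin n) ℂ) : Matrix (Fin n) (Fin n) ℂ) *
        (φ A * φ B) * (T : Matrix (Fin n) (Fin n) ℂ) := by
      intro A B
      simp only [hS]
      calc _ = ((T⁻¹ : GL (Fin n) ℂ) : Matrix (Fin n) (Fin n) ℂ) * φ A *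
            ((T : Matrix (Fin n) (Fin n) ℂ) * ((T⁻¹ : GL (Fin n) ℂ) : Matrix (Fin n) (Fin n) ℂ)) *
            φ B * (T : Matrix (Fin n) (Fin n) ℂ) := by simp only [mul_assoc]
        _ = _ := by rw [hTT]; simp only [mul_assoc, mul_one]
    change S X * S Z = S Z * S X
    rw [hmul, hmul, hc.eq]
  have hSd : ∀ X, S X = Matrix.diagonal fun i => S X i i := fun X => ((hSdiag X).diagonal_diag).symm
  refine ⟨T, fun i X => S X i i, fun i => ?_, fun X => ?_, fun X => ?_⟩
  · exact ((continuous_const.mul hcont).mul continuous_const).matrix_elem i i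
  · rw [← hSd]; exact hSφ X
  · rw [← hspecX, hSφ X, ← spectrum_diagonal, ← hSd]
    exact (spectrum.units_conjugate (u := T)).symm

/-! ### Relabelling and conclusion -/

lemma matrixAd_mul {n : ℕ} (T U : GL (Fin n) ℂ) (A : Matrix (Fin n) (Fin n) ℂ) :
    matrixAd (T * U) A = matrixAd T (matrixAd U A) := by
  simp [matrixAd, mul_inv_rev, mul_assoc]

lemma exists_matrixAd_diagonal_comp {n : ℕ} (σ : Equiv.Perm (Fin n)) :
    ∃ P : GL (Fin n) ℂ, ∀ d : Fin n → ℂ,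
      Matrix.diagonal (d ∘ σ) = matrixAd P (Matrix.diagonal d) := by
  refine ⟨⟨σ.permMatrix ℂ, σ⁻¹.permMatrix ℂ, ?_, ?_⟩, fun d => ?_⟩
  · rw [← Matrix.permMatrix_mul]; simp
  · rw [← Matrix.permMatrix_mul]; simp
  · change _ = σ.permMatrix ℂ * Matrix.diagonal d * σ⁻¹.permMatrix ℂ
    ext i j
    simp [Matrix.mul_apply, Matrix.diagonal_apply, Equiv.Perm.permMatrix, PEquiv.toMatrix_apply,
      Equiv.toPEquiv_apply]
    rw [Finset.sum_eq_single (σ i)] <;> aesop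

theorem theorem1p2 (n : ℕ) (hn : 1 ≤ n) (φ : diagSU n → Matrix (Fin n) (Fin n) ℂ)
    (hcont : Continuous φ) (hspec : SpectrumPreserving φ) (hcomm : CommutativityPreserving φ) :
    (∀ X : diagSU n, ∃! x : Fin n → ℝ, IsOrderedEigenangles (diagSU.toMatrix X) x) ∧
      ((∃ T : GL (Fin n) ℂ, ∀ X : diagSU n, φ X = matrixAd T (diagSU.toMatrix X)) ∨
        (∃ T : GL (Fin n) ℂ, ∀ (X : diagSU n) (x : Fin n → ℝ),
          IsOrderedEigenangles (diagSU.toMatrix X) x →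
            φ X = matrixAd T (Matrix.diagonal fun j => circleExp (x j)))) := by
  refine ⟨existsUnique_isOrderedEigenangles, ?_⟩
  obtain ⟨T, f, hf, hφ, hrange⟩ := exists_simultaneous_diagonalization φ hcont hspec hcomm
  have hb := barycentre_mem (n := n)
  have hinj : ∀ u : Equiv.Perm (Fin n),
      Function.Injective fun i => f i (torusPoint (barycentre n ∘ u)) := by
    intro u
    have hd : Function.Injective fun i =>
        diagSU.toMatrix (torusPoint (barycentre n ∘ u)) i i := by
      simp only [torusPoint_comp_apply (openAlcove_subset hb)]
      exact (circleExp_injective_of_mem_openAlcove hb).comp u.injective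
    -- At a regular element the range of the `f i` has `n` elements, so no two of them agree.
    have hcard := congrArg Set.ncard (hrange (torusPoint (barycentre n ∘ u)))
    rw [← Set.image_univ, ← Set.image_univ, Set.ncard_image_of_injective _ hd] at hcard
    exact Set.injOn_univ.1 (Set.injOn_of_ncard_image_eq hcard)
  have hdich : ∀ i, _ := fun i => ordered_or_diag_of_continuous_selection hn (f i) (hf i)
    (fun X => by
      have : f i X ∈ Set.range fun i => diagSU.toMatrix X i i := hrange X ▸ ⟨i, rfl⟩
      obtain ⟨j, hj⟩ := this
      exact ⟨j, hj.symm⟩)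
  by_cases hall : ∀ i, ∃ j, ∀ X, f i X = diagSU.toMatrix X j j
  · left
    choose s hs using hall
    have hsinj : Function.Injective s := fun i k h => hinj 1 (by simp only [hs, h])
    set σ : Equiv.Perm (Fin n) := Equiv.ofBijective s (Finite.injective_iff_bijective.1 hsinj)
    obtain ⟨P, hP⟩ := exists_matrixAd_diagonal_comp σ
    refine ⟨T * P, fun X => ?_⟩
    rw [hφ, matrixAd_mul, diagSU.toMatrix_eq_diagonal X, ← hP]
    congr 2
    funext i
    exact hs i X
  · right
    push Not at hall
    obtain ⟨i₀, hi₀⟩ := hall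
    obtain ⟨p₀, hp₀⟩ := (hdich i₀).resolve_right (by push Not; exact hi₀)
    have hord : ∀ i, ∃ p, ∀ x ∈ alcove n, ∀ u : Equiv.Perm (Fin n),
        f i (torusPoint (x ∘ u)) = circleExp (x p) := by
      intro i
      refine (hdich i).resolve_right ?_
      rintro ⟨j, hj⟩
      have hne : i ≠ i₀ := by
        rintro rfl
        obtain ⟨X, hX⟩ := hi₀ j
        exact hX (hj X)
      -- The swap puts the ordered eigenvalue `p₀` into diagonal entry `j`, so `f i` and `f i₀`
      -- would agree at this regular element.
      refine hne (hinj (Equiv.swap j p₀) ?_)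
      simp only [hj, hp₀ _ (openAlcove_subset hb), torusPoint_comp_apply (openAlcove_subset hb),
        Equiv.swap_apply_left]
    choose s hs using hord
    have hsinj : Function.Injective s := fun i k h => hinj 1 (by
      simp only [hs _ _ (openAlcove_subset hb), h])
    set σ : Equiv.Perm (Fin n) := Equiv.ofBijective s (Finite.injective_iff_bijective.1 hsinj)
    obtain ⟨P, hP⟩ := exists_matrixAd_diagonal_comp σ
    refine ⟨T * P, fun X x hx => ?_⟩
    obtain ⟨hmem, u, rfl⟩ := (isOrderedEigenangles_iff X x).1 hx
    rw [hφ, matrixAd_mul, ← hP]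
    congr 2
    funext i
    exact hs i x hmem u
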